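/- Let $\mathcal C$ be a pointed model category (its initial object is also terminal; denote it by $*$) with functorial factorizations. Let $i : A \to B$ and $i' : A' \to B'$ be cofibrations in $\mathcal C$ that are weakly equivalent: they are connected by a finite zig-zag, in the category $\mathrm{Ar}\,\mathcal C$ of morphisms and commutative squares of $\mathcal C$, of commutative squares both of whose horizontal maps are weak equivalences (the intermediate objects of the zig-zag may be arbitrary morphisms of $\mathcal C$). Suppose that $A$ and $A'$ are both cofibrant, or that $\mathcal C$ is left proper (cobase changes of weak equivalences along cofibrations are weak equivalences). Then $i$ has a fibrant obstruction theory if and only if $i'$ has a fibrant obstruction theory. Here a cofibration $i$ *has a fibrant obstruction theory* if there are an object $W$ of $\mathcal C$ and an assignment, to every fibration $p : X \to Y$ with $Y$ fibrant and every morphism $s : i \to p$ in $\mathrm{Ar}\,\mathcal C$ (that is, a commutative square from $i$ to $p$), of an element $\alpha(s)$ of $[W, F]$, the set of morphisms from $W$ to $F$ in the homotopy category of $\mathcal C$, where $F = * \times_Y X$ is the fibre of $p$, such that 1. the square $s$ has a lift $B \to X$ if and only if $\alpha(s)$ is the trivial class, i.e. the class of $W \to * \to F$; 2. for every morphism $g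 : p \to p'$ in $\mathrm{Ar}\,\mathcal C$ between fibrations with fibrant targets, with fibres $F$ and $F'$, and for every $s : i \to p$, the class $\alpha(g \circ s)$ is the composition of $\alpha(s)$ with the class of the induced map $F \to F'$. -/

import Mathlib

open CategoryTheory Limits HomotopicalAlgebra

universe v u

namespace ObstructionTheory

noncomputable section

variable {C : Type u} [Category.{v} C]

section ModelCategory

variable [ModelCategory C]

variable (C) in
/-- A model category is left proper if every cobase change of a weak equivalence along a
cofibration is a weak equivalence. -/
def IsLeftProper : Prop :=
  ∀ ⦃A B A' B' : C⦄ (i : A ⟶ B) (f : A ⟶ A') (g : B ⟶ B') (i' : A' ⟶ B'),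
    IsPushout f i i' g → Cofibration i → WeakEquivalence f → WeakEquivalence g

/-- Two arrows are weakly equivalent if they are connected by a finite zig-zag of levelwise
weak equivalences, that is, of commutative squares whose two horizontal maps are weak
equivalences; the intermediate arrows are arbitrary. -/
def WeaklyEquivalent (f g : Arrow C) : Prop :=
  Relation.EqvGen (fun f₁ f₂ : Arrow C ↦ ∃ φ : f₁ ⟶ f₂, (weakEquivalences C).arrow φ) f g

/-- The set `[X, Y]` of weak homotopy classes of maps from `X` to `Y`, i.e. of morphisms in
the homotopy category, the localization of `C` at the weak equivalences. -/
abbrev WeakHomotopyClass (X Y : C) : Type max u v :=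
  (weakEquivalences C).Q.obj X ⟶ (weakEquivalences C).Q.obj Y

/-- The weak homotopy class of a map. -/
abbrev homotopyClass {X Y : C} (f : X ⟶ Y) : WeakHomotopyClass X Y :=
  (weakEquivalences C).Q.map f

/-- A commutative square from `i` to `p` has a lift. -/
def HasLift {i p : Arrow C} (s : i ⟶ p) : Prop :=
  ∃ l : i.right ⟶ p.left, i.hom ≫ l = s.left ∧ l ≫ p.hom = s.right

variable [HasZeroMorphisms C]

/-- The fibre of a map `p : X ⟶ Y` of a pointed category: the base change of `p` along
`* ⟶ Y`, that is, the kernel of `p` (see `isPullback_fibre`). -/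
abbrev fibre (p : Arrow C) : C := kernel p.hom

/-- The map on fibres induced by a commutative square. -/
abbrev fibreMap {p p' : Arrow C} (g : p ⟶ p') : fibre p ⟶ fibre p' :=
  kernel.map p.hom p'.hom g.left g.right g.w.symm

open scoped ZeroObject in
/-- The fibre is the pullback of `p` along the map from the zero object. -/
theorem isPullback_fibre [HasZeroObject C] (p : Arrow C) :
    IsPullback (kernel.ι p.hom) (0 : fibre p ⟶ 0) p.hom (0 : 0 ⟶ p.right) :=
  IsPullback.of_isLimit' ⟨by simp⟩ (PullbackCone.IsLimit.mk _
    (fun s ↦ kernel.lift p.hom s.fst (by rw [s.condition, comp_zero]))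
    (fun s ↦ by simp) (fun s ↦ (isZero_zero C).eq_of_tgt _ _)
    (fun s m h _ ↦ by ext; simp [h]))

/-- A fibrant obstruction theory for `i`: an object `W` together with, for each fibration `p`
with fibrant target and each square `s : i ⟶ p`, an obstruction in `[W, fibre p]`
which is trivial if and only if `s` has a lift, and which is functorial in `p`. -/
structure FibrantObstructionTheory (i : Arrow C) where
  W : C
  obstruction (p : Arrow C) (hp : Fibration p.hom) (hY : IsFibrant p.right) (s : i ⟶ p) :
    WeakHomotopyClass W (fibre p)
  hasLift_iff (p : Arrow C) (hp : Fibration p.hom) (hY : IsFibrant p.right) (s : i ⟶ p) :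
    HasLift s ↔ obstruction p hp hY s = homotopyClass (0 : W ⟶ fibre p)
  functorial (p p' : Arrow C) (hp : Fibration p.hom) (hY : IsFibrant p.right)
    (hp' : Fibration p'.hom) (hY' : IsFibrant p'.right) (s : i ⟶ p) (g : p ⟶ p') :
    obstruction p' hp' hY' (s ≫ g) = obstruction p hp hY s ≫ homotopyClass (fibreMap g)

/-- The map `i` has a fibrant obstruction theory. -/
def HasFibrantObstructionTheory (i : Arrow C) : Prop :=
  Nonempty (FibrantObstructionTheory i)

end ModelCategory

end

end ObstructionTheory

/-! Consider a levelwise weak equivalence `f : i ⟶ i'` of cofibrations whose components stay weak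
equivalences under cobase change along cofibrations. A theory for `i` gives one for `i'` by
assigning to `s` the obstruction of `f ≫ s`, since lifting against a fibration is insensitive to `f`
(`hasLift_precomp_iff`). Conversely, a square `s : i ⟶ p` need not extend along `f`, but it does
after changing `p`. Factor `s` as a levelwise cofibration `i ⟶ P s` and a levelwise trivial
fibration, push out along `f` to get `E f s`, and replace everything by fibrations with fibrant
targets. The resulting zig-zag `p ⟶ R p ⟵ R (P s) ⟶ R (E f s)` of weak equivalences preserves
liftability (`hasLift_comp_iff`) and induces isomorphisms between fibres in the homotopy category
(`weakEquivalence_fibreMap`), so the obstruction of the extended square can be carried back to `p`.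
The cobase change condition holds in a left proper category, and for weak equivalences between
cofibrant objects (`weakEquivalence_of_isPushout_of_isCofibrant`). An arbitrary zig-zag reduces to
the cofibrant case by functorial replacement; only the comparison of each end with its replacement
needs the cofibrancy or properness assumption. -/

namespace ObstructionTheory

/-! ### Cobase change of weak equivalences. -/

section CobaseChange

variable {C : Type u} [Category.{v} C] [ModelCategory C]

theorem weakEquivalence_of_isPushout {X Y X' Y' : C} {f : X ⟶ X'} {g : X ⟶ Y}
    {g' : X' ⟶ Y'} {f' : Y ⟶ Y'} (sq : IsPushout f g g' f') [Cofibration f]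
    [WeakEquivalence f] : WeakEquivalence f' := by
  rw [weakEquivalence_iff]
  exact (MorphismProperty.of_isPushout sq.flip (mem_trivialCofibrations f)).2

theorem cofibration_of_isPushout {X Y X' Y' : C} {f : X ⟶ X'} {g : X ⟶ Y}
    {g' : X' ⟶ Y'} {f' : Y ⟶ Y'} (sq : IsPushout f g g' f') [hf : Cofibration f] :
    Cofibration f' := by
  rw [cofibration_iff] at hf ⊢
  exact MorphismProperty.of_isPushout sq.flip hf

theorem exists_isPushout {X Y Z : C} (f : X ⟶ Y) (g : X ⟶ Z) :
    ∃ (P : C) (a : Y ⟶ P) (b : Z ⟶ P), IsPushout f g a b :=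
  ⟨_, _, _, IsPushout.of_hasPushout f g⟩

/-- **Ken Brown's lemma** for the cobase change functor along `r`: it sends weak equivalences
between cofibrations under `Z` to weak equivalences. -/
theorem weakEquivalence_cobaseChange {Z Z' D D' E E' : C} {r : Z ⟶ Z'}
    {c : Z ⟶ D} {d : Z' ⟶ E} {e : D ⟶ E} (sq : IsPushout r c d e)
    {c' : Z ⟶ D'} {d' : Z' ⟶ E'} {e' : D' ⟶ E'} (sq' : IsPushout r c' d' e')
    [Cofibration c] [Cofibration c'] (g : D ⟶ D') [WeakEquivalence g] (hg : c ≫ g = c')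
    (h : E ⟶ E') (hd : d ≫ h = d') (he : e ≫ h = g ≫ e') : WeakEquivalence h := by
  obtain ⟨P, l, r', sqP⟩ := exists_isPushout c c'
  have : Cofibration l := cofibration_of_isPushout sqP.flip
  have : Cofibration r' := cofibration_of_isPushout sqP
  -- The mapping cylinder of `g` under `Z`: both `a` and `b` become trivial cofibrations, hence so
  -- do their cobase changes `u` and `u'`. The map `q` retracts `u'`, so it is a weak equivalence,
  -- and `h = u ≫ q`.
  let F := MorphismProperty.factorizationData (cofibrations C) (trivialFibrations C)
    (sqP.desc g (𝟙 D') (by simp [hg]))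
  let a : D ⟶ F.Z := l ≫ F.i
  let b : D' ⟶ F.Z := r' ≫ F.i
  have ha : a ≫ F.p = g := by simp [a]
  have hb : b ≫ F.p = 𝟙 D' := by simp [b]
  have hab : c ≫ a = c' ≫ b := by simp [a, b, sqP.w_assoc]
  have : WeakEquivalence a := weakEquivalence_of_postcomp_of_fac ha
  have : WeakEquivalence b := weakEquivalence_of_postcomp_of_fac hb
  have : Cofibration a := by dsimp [a]; infer_instance
  have : Cofibration b := by dsimp [b]; infer_instance
  obtain ⟨Q, x, y, sqQ⟩ := exists_isPushout r (c ≫ a)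
  let u : E ⟶ Q := sq.desc x (a ≫ y) (by simpa using sqQ.w)
  let u' : E' ⟶ Q := sq'.desc x (b ≫ y) (by simpa [hab] using sqQ.w)
  let q : Q ⟶ E' := sqQ.desc d' (F.p ≫ e') (by
    rw [sq'.w, Category.assoc, reassoc_of% ha, reassoc_of% hg])
  have pu : IsPushout a e y u := IsPushout.of_left (by simpa [u] using sqQ.flip) (by simp [u]) sq.flip
  have pu' : IsPushout b e' y u' :=
    IsPushout.of_left (by simpa [hab, u'] using sqQ.flip) (by simp [u']) sq'.flip
  have : WeakEquivalence u := weakEquivalence_of_isPushout pu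
  have : WeakEquivalence u' := weakEquivalence_of_isPushout pu'
  have hu'q : u' ≫ q = 𝟙 E' := sq'.hom_ext (by simp [u', q]) (by simp [u', q, reassoc_of% hb])
  have : WeakEquivalence q := weakEquivalence_of_precomp_of_fac hu'q
  have huq : u ≫ q = h := sq.hom_ext (by simp [u, q, hd]) (by simp [u, q, reassoc_of% ha, he])
  rw [← huq]
  infer_instance

/-- Ken Brown's lemma needs a weak equivalence under `Z`, and `e` is not one of its instances. The
section produces a suitable cofibration `x : Z ⟶ G` with a weak equivalence `g : G ⟶ D` under `Z`,
whose cobase change along `r` is a weak equivalence followed by `e`. -/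
theorem weakEquivalence_of_isPushout_of_section {Z A' D E : C} {r : Z ⟶ A'} {c : Z ⟶ D}
    {d : A' ⟶ E} {e : D ⟶ E} (sq : IsPushout r c d e) [Cofibration c]
    (t : A' ⟶ Z) [Cofibration t] [WeakEquivalence t] (ht : t ≫ r = 𝟙 A') :
    WeakEquivalence e := by
  let F := MorphismProperty.factorizationData (cofibrations C) (trivialFibrations C) (t ≫ c)
  obtain ⟨G, x, y, sqG⟩ := exists_isPushout t F.i
  have : WeakEquivalence y := weakEquivalence_of_isPushout sqG
  have : Cofibration x := cofibration_of_isPushout sqG.flip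
  let g : G ⟶ D := sqG.desc c F.p (by simp)
  have hg : y ≫ g = F.p := by simp [g]
  have : WeakEquivalence g := weakEquivalence_of_precomp_of_fac hg
  let m : G ⟶ F.Z := sqG.desc (r ≫ F.i) (𝟙 _) (by simp [reassoc_of% ht])
  -- Since `t ≫ r = 𝟙`, pushing `F.i` out along `t` and then along `r` returns `F.i`.
  have sqm : IsPushout r x F.i m :=
    IsPushout.of_left (h₁₁ := t) (v₁₁ := F.i) (h₂₁ := y)
      (by simpa [ht, m] using IsPushout.id_horiz F.i) (by simp [m]) sqG
  have : WeakEquivalence (F.p ≫ e) := weakEquivalence_cobaseChange sqm sq g (by simp [g]) _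
    (by rw [MorphismProperty.MapFactorizationData.fac_assoc, Category.assoc, ← sq.w,
      reassoc_of% ht])
    (sqG.hom_ext (by simp [m, g, ← sq.w, reassoc_of% ht]) (by simp [m, g]))
  exact weakEquivalence_of_precomp F.p e

/-- Weak equivalences between cofibrant objects are stable under cobase change along
cofibrations. -/
theorem weakEquivalence_of_isPushout_of_isCofibrant {A A' D E : C} {w : A ⟶ A'} {c : A ⟶ D}
    {d : A' ⟶ E} {e : D ⟶ E} (sq : IsPushout w c d e) [Cofibration c] [WeakEquivalence w]
    [IsCofibrant A] [IsCofibrant A'] : WeakEquivalence e := by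
  obtain ⟨h⟩ : Nonempty (CofibrantBrownFactorization w) := inferInstance
  obtain ⟨P, x, y, sq₁⟩ := exists_isPushout h.i c
  have : WeakEquivalence y := weakEquivalence_of_isPushout sq₁
  have : Cofibration x := cofibration_of_isPushout sq₁.flip
  let m : P ⟶ E := sq₁.desc (h.p ≫ d) e (by simp [sq.w])
  have sq₂ : IsPushout h.p x d m := IsPushout.of_left (by simpa [m] using sq) (by simp [m]) sq₁
  have : WeakEquivalence m := weakEquivalence_of_isPushout_of_section sq₂ h.s h.s_p
  have hm : y ≫ m = e := by simp [m]
  rw [← hm]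
  infer_instance

end CobaseChange

/-! ### The dual statements for base change. -/

section BaseChange

variable {C : Type u} [Category.{v} C] [ModelCategory C]

theorem isCofibrant_op (X : C) [hX : IsFibrant X] : IsCofibrant (Opposite.op X) := by
  rw [isCofibrant_iff_of_isInitial (terminal.from X).op (initialOpOfTerminal terminalIsTerminal)]
  infer_instance

/-- **Ken Brown's lemma** for the base change functor along `r`. -/
theorem weakEquivalence_baseChange {Z Z' D D' E E' : C} {r : Z' ⟶ Z}
    {c : D ⟶ Z} {d : E ⟶ Z'} {e : E ⟶ D} (sq : IsPullback e d c r)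
    {c' : D' ⟶ Z} {d' : E' ⟶ Z'} {e' : E' ⟶ D'} (sq' : IsPullback e' d' c' r)
    [Fibration c] [Fibration c'] (g : D' ⟶ D) [WeakEquivalence g] (hg : g ≫ c = c')
    (h : E' ⟶ E) (hd : h ≫ d = d') (he : h ≫ e = e' ≫ g) : WeakEquivalence h := by
  rw [← weakEquivalences_op_iff]
  exact weakEquivalence_cobaseChange sq.op sq'.op g.op (by rw [← hg, op_comp]) h.op
    (by rw [← hd, op_comp]) (by rw [← op_comp, he, op_comp])

/-- Weak equivalences between fibrant objects are stable under base change along fibrations. -/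
theorem weakEquivalence_of_isPullback_of_isFibrant {Y Y' D E : C} {w : Y ⟶ Y'} {c : D ⟶ Y'}
    {d : E ⟶ Y} {e : E ⟶ D} (sq : IsPullback e d c w) [Fibration c] [WeakEquivalence w]
    [IsFibrant Y] [IsFibrant Y'] : WeakEquivalence e := by
  have := isCofibrant_op Y
  have := isCofibrant_op Y'
  rw [← weakEquivalences_op_iff]
  exact weakEquivalence_of_isPushout_of_isCofibrant sq.op

end BaseChange

end ObstructionTheory
-- Invariance of lifts and of fibres under weak equivalences.
namespace ObstructionTheory

section

variable {C : Type u} [Category.{v} C]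

theorem HasLift.comp {i p p' : Arrow C} {s : i ⟶ p} (h : HasLift s) (g : p ⟶ p') :
    HasLift (s ≫ g) := by
  obtain ⟨l, h₁, h₂⟩ := h
  exact ⟨l ≫ g.left, by simp [reassoc_of% h₁], by simp [reassoc_of% h₂]⟩

theorem HasLift.precomp {i i' p : Arrow C} {s : i' ⟶ p} (h : HasLift s) (f : i ⟶ i') :
    HasLift (f ≫ s) := by
  obtain ⟨l, h₁, h₂⟩ := h
  exact ⟨f.right ≫ l, by simp [← h₁], by simp [h₂]⟩

end

section HasLift

variable {C : Type u} [Category.{v} C] [ModelCategory C]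

/-- All cobase changes of `w` along cofibrations are weak equivalences. -/
def IsCobaseChangeWeakEquivalence {A A' : C} (w : A ⟶ A') : Prop :=
  ∀ ⦃D E : C⦄ (c : A ⟶ D) (d : A' ⟶ E) (e : D ⟶ E),
    IsPushout w c d e → Cofibration c → WeakEquivalence e

theorem IsCobaseChangeWeakEquivalence.of_isCofibrant {A A' : C} (w : A ⟶ A')
    [WeakEquivalence w] [IsCofibrant A] [IsCofibrant A'] : IsCobaseChangeWeakEquivalence w :=
  fun _ _ _ _ _ sq _ ↦ weakEquivalence_of_isPushout_of_isCofibrant sq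

theorem IsLeftProper.isCobaseChangeWeakEquivalence (hC : IsLeftProper C) {A A' : C} (w : A ⟶ A')
    [WeakEquivalence w] : IsCobaseChangeWeakEquivalence w :=
  fun _ _ c d e sq _ ↦ hC c w e d sq inferInstance inferInstance

/-- The existence of lifts against a fibration is invariant under weak equivalences of
cofibrations. -/
theorem hasLift_precomp_iff {i i' p : Arrow C} (f : i ⟶ i') [Cofibration i.hom]
    [Cofibration i'.hom] [Fibration p.hom] [WeakEquivalence f.right]
    (hf : IsCobaseChangeWeakEquivalence f.left) (s : i' ⟶ p) :
    HasLift (f ≫ s) ↔ HasLift s := by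
  refine ⟨fun ⟨l, h₁, h₂⟩ ↦ ?_, fun h ↦ h.precomp f⟩
  simp only [Arrow.comp_left, Arrow.comp_right] at h₁ h₂
  obtain ⟨P, x, y, sq⟩ := exists_isPushout f.left i.hom
  have : WeakEquivalence y := hf _ _ _ sq inferInstance
  let m : P ⟶ i'.right := sq.desc i'.hom f.right f.w
  have hm : y ≫ m = f.right := by simp [m]
  have : WeakEquivalence m := weakEquivalence_of_precomp_of_fac hm
  -- `P` carries the map to `p.left` glued from `s.left` and `l`. It extends over the trivial
  -- cofibration `F.i`, while `i'.hom` lifts against the trivial fibration `F.p`.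
  let F := MorphismProperty.factorizationData (trivialCofibrations C) (fibrations C) m
  have : WeakEquivalence F.p := weakEquivalence_of_precomp_of_fac F.fac
  have sq₁ : CommSq (x ≫ F.i) i'.hom F.p (𝟙 _) := ⟨by simp [m]⟩
  have sq₂ : CommSq (sq.desc s.left l h₁.symm) F.i p.hom (F.p ≫ s.right) :=
    ⟨sq.hom_ext (by simp [m]) (by simp [m, h₂])⟩
  refine ⟨sq₁.lift ≫ sq₂.lift, ?_, ?_⟩
  · rw [sq₁.fac_left_assoc, Category.assoc, sq₂.fac_left, sq.inl_desc]
  · rw [Category.assoc, sq₂.fac_right, sq₁.fac_right_assoc, Category.id_comp]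

/-- The existence of lifts of a cofibration is invariant under weak equivalences of
fibrations between fibrant objects. -/
theorem hasLift_comp_iff {i p p' : Arrow C} (g : p ⟶ p') [Cofibration i.hom]
    [Fibration p.hom] [Fibration p'.hom] [WeakEquivalence g.left] [WeakEquivalence g.right]
    [IsFibrant p.right] [IsFibrant p'.right] (s : i ⟶ p) :
    HasLift (s ≫ g) ↔ HasLift s := by
  refine ⟨fun ⟨l, h₁, h₂⟩ ↦ ?_, fun h ↦ h.comp g⟩
  simp only [Arrow.comp_left, Arrow.comp_right] at h₁ h₂
  have sq := IsPullback.of_hasPullback p'.hom g.right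
  generalize pullback p'.hom g.right = P, pullback.fst p'.hom g.right = x,
    pullback.snd p'.hom g.right = y at sq
  have : WeakEquivalence x := weakEquivalence_of_isPullback_of_isFibrant sq
  let m : p.left ⟶ P := sq.lift g.left p.hom g.w
  have hm : m ≫ x = g.left := by simp [m]
  have : WeakEquivalence m := weakEquivalence_of_postcomp_of_fac hm
  let F := MorphismProperty.factorizationData (trivialCofibrations C) (fibrations C) m
  have : WeakEquivalence F.p := weakEquivalence_of_precomp_of_fac F.fac
  -- A retraction of `F.i` over `p.right`; it brings a lift into `F.Z` back to `p.left`.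
  have sq₁ : CommSq (𝟙 _) F.i p.hom (F.p ≫ y) := ⟨by simp [m]⟩
  have sq₂ : CommSq (s.left ≫ F.i) i.hom F.p (sq.lift l s.right h₂) :=
    ⟨sq.hom_ext (by simp [m, h₁]) (by simp [m])⟩
  refine ⟨sq₂.lift ≫ sq₁.lift, ?_, ?_⟩
  · rw [sq₂.fac_left_assoc, Category.assoc, sq₁.fac_left, Category.comp_id]
  · rw [Category.assoc, sq₁.fac_right, sq₂.fac_right_assoc, sq.lift_snd]

end HasLift

section Fibre

variable {C : Type u} [Category.{v} C] [HasZeroMorphisms C]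

variable [ModelCategory C]

theorem fibreMap_comp {p p' p'' : Arrow C} (g : p ⟶ p') (g' : p' ⟶ p'') :
    fibreMap (g ≫ g') = fibreMap g ≫ fibreMap g' := by
  ext
  simp

variable [HasZeroObject C]

open scoped ZeroObject in
/-- A weak equivalence between fibrations with fibrant targets induces a weak equivalence on
fibres. -/
theorem weakEquivalence_fibreMap {p p' : Arrow C} (g : p ⟶ p')
    [Fibration p.hom] [Fibration p'.hom] [WeakEquivalence g.left] [WeakEquivalence g.right]
    [IsFibrant p.right] [IsFibrant p'.right] : WeakEquivalence (fibreMap g) := by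
  have sq := IsPullback.of_hasPullback p'.hom g.right
  generalize pullback p'.hom g.right = P, pullback.fst p'.hom g.right = x,
    pullback.snd p'.hom g.right = y at sq
  have : WeakEquivalence x := weakEquivalence_of_isPullback_of_isFibrant sq
  have : Fibration y := by
    have h := mem_fibrations p'.hom
    rw [fibration_iff]
    exact MorphismProperty.of_isPullback sq h
  let m : p.left ⟶ P := sq.lift g.left p.hom g.w
  have hm : m ≫ x = g.left := by simp [m]
  have : WeakEquivalence m := weakEquivalence_of_postcomp_of_fac hm
  let k : fibre p' ⟶ P := sq.lift (kernel.ι p'.hom) 0 (by simp)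
  -- The fibre of `p'` is also the fibre of its base change `y`, so the map on fibres is the base
  -- change of `m` along `0 ⟶ p.right`.
  have sqk : IsPullback k (0 : fibre p' ⟶ 0) y (0 : 0 ⟶ p.right) :=
    IsPullback.of_right (by simpa [k] using isPullback_fibre p') (by simp [k]) sq
  exact weakEquivalence_baseChange sqk (isPullback_fibre p) m (by simp [m]) (fibreMap g)
    (by simp) (sq.hom_ext (by simp [m, k]) (by simp [m, k]))

end Fibre

end ObstructionTheory
-- Functorial replacements, levelwise factorizations and levelwise pushouts of arrows.
namespace ObstructionTheory

open MorphismProperty (FunctorialFactorizationData)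

noncomputable section

namespace FactorizationFunctor

variable {C : Type u} [Category.{v} C] {W₁ W₂ : MorphismProperty C}
  (D : FunctorialFactorizationData W₁ W₂)

/-- The middle object of the functorial factorization of a morphism. -/
def mid {X Y : C} (f : X ⟶ Y) : C := D.Z.obj (Arrow.mk f)

/-- The first morphism of the functorial factorization of a morphism. -/
def ι {X Y : C} (f : X ⟶ Y) : X ⟶ mid D f := D.i.app (Arrow.mk f)

/-- The second morphism of the functorial factorization of a morphism. -/
def π {X Y : C} (f : X ⟶ Y) : mid D f ⟶ Y := D.p.app (Arrow.mk f)

/-- The functoriality of the factorization. -/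
def map {X Y X' Y' : C} {f : X ⟶ Y} {f' : X' ⟶ Y'} (a : X ⟶ X') (b : Y ⟶ Y')
    (w : a ≫ f' = f ≫ b) : mid D f ⟶ mid D f' :=
  D.Z.map (Arrow.homMk a b w : Arrow.mk f ⟶ Arrow.mk f')

theorem ι_mem {X Y : C} (f : X ⟶ Y) : W₁ (ι D f) := D.hi _

theorem π_mem {X Y : C} (f : X ⟶ Y) : W₂ (π D f) := D.hp _

@[simp]
theorem ι_π {X Y : C} (f : X ⟶ Y) : ι D f ≫ π D f = f := D.fac_app

@[simp]
theorem ι_map {X Y X' Y' : C} {f : X ⟶ Y} {f' : X' ⟶ Y'} (a : X ⟶ X') (b : Y ⟶ Y')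
    (w : a ≫ f' = f ≫ b) : ι D f ≫ map D a b w = a ≫ ι D f' :=
  (D.i.naturality (Arrow.homMk a b w : Arrow.mk f ⟶ Arrow.mk f')).symm

@[simp]
theorem map_π {X Y X' Y' : C} {f : X ⟶ Y} {f' : X' ⟶ Y'} (a : X ⟶ X') (b : Y ⟶ Y')
    (w : a ≫ f' = f ≫ b) : map D a b w ≫ π D f' = π D f ≫ b :=
  D.p.naturality (Arrow.homMk a b w : Arrow.mk f ⟶ Arrow.mk f')

@[simp]
theorem map_map {X Y X' Y' X'' Y'' : C} {f : X ⟶ Y} {f' : X' ⟶ Y'} {f'' : X'' ⟶ Y''}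
    (a : X ⟶ X') (b : Y ⟶ Y') (w : a ≫ f' = f ≫ b)
    (a' : X' ⟶ X'') (b' : Y' ⟶ Y'') (w' : a' ≫ f'' = f' ≫ b') :
    map D a b w ≫ map D a' b' w' =
      map D (a ≫ a') (b ≫ b') (by rw [Category.assoc, w', reassoc_of% w]) :=
  (D.Z.map_comp _ _).symm

end FactorizationFunctor

variable {C : Type u} [Category.{v} C] [ModelCategory C]

namespace FibrantReplacement

variable (D : FunctorialFactorizationData (trivialCofibrations C) (fibrations C))

/-- The functorial fibrant replacement of an object. -/
abbrev obj (X : C) : C := FactorizationFunctor.mid D (terminal.from X)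

/-- The functorial fibrant replacement of a morphism. -/
abbrev map {X Y : C} (f : X ⟶ Y) : obj D X ⟶ obj D Y :=
  FactorizationFunctor.map D f (𝟙 _) (Subsingleton.elim _ _)

/-- The inclusion of an object into its fibrant replacement. -/
abbrev ι (X : C) : X ⟶ obj D X := FactorizationFunctor.ι D (terminal.from X)

instance (X : C) : IsFibrant (obj D X) := by
  rw [isFibrant_iff_of_isTerminal (FactorizationFunctor.π D (terminal.from X))
    terminalIsTerminal]
  exact ⟨FactorizationFunctor.π_mem D _⟩

/-- The functorial replacement of an arrow by a fibration with fibrant target. -/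
abbrev arrowObj (f : Arrow C) : Arrow C :=
  Arrow.mk (FactorizationFunctor.π D (f.hom ≫ ι D f.right))

/-- The action of `arrowObj` on commutative squares. -/
abbrev arrowMap {f g : Arrow C} (φ : f ⟶ g) : arrowObj D f ⟶ arrowObj D g :=
  Arrow.homMk (FactorizationFunctor.map D φ.left (map D φ.right) (by simp)) (map D φ.right)
    (by simp)

theorem arrowMap_comp {f g h : Arrow C} (φ : f ⟶ g) (ψ : g ⟶ h) :
    arrowMap D (φ ≫ ψ) = arrowMap D φ ≫ arrowMap D ψ := by
  ext <;> simp

/-- The inclusion of an arrow into its replacement by a fibration with fibrant target. -/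
abbrev arrowι (f : Arrow C) : f ⟶ arrowObj D f :=
  Arrow.homMk (FactorizationFunctor.ι D (f.hom ≫ ι D f.right)) (ι D f.right) (by simp)

theorem arrowι_map {f g : Arrow C} (φ : f ⟶ g) :
    arrowι D f ≫ arrowMap D φ = φ ≫ arrowι D g := by
  ext <;> simp

theorem fibration_arrowObj (f : Arrow C) : Fibration (arrowObj D f).hom :=
  ⟨FactorizationFunctor.π_mem D _⟩

theorem isFibrant_arrowObj_right (f : Arrow C) : IsFibrant (arrowObj D f).right :=
  inferInstanceAs (IsFibrant (obj D f.right))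

theorem arrow_arrowι (f : Arrow C) : (weakEquivalences C).arrow (arrowι D f) :=
  ⟨(FactorizationFunctor.ι_mem D _).2, (FactorizationFunctor.ι_mem D _).2⟩

theorem arrow_arrowMap {f g : Arrow C} (φ : f ⟶ g) (hφ : (weakEquivalences C).arrow φ) :
    (weakEquivalences C).arrow (arrowMap D φ) := by
  have h : (weakEquivalences C).arrow (arrowι D f ≫ arrowMap D φ) := by
    rw [arrowι_map]
    exact ⟨MorphismProperty.comp_mem _ _ _ hφ.1 (arrow_arrowι D g).1,
      MorphismProperty.comp_mem _ _ _ hφ.2 (arrow_arrowι D g).2⟩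
  exact ⟨MorphismProperty.of_precomp _ _ _ (arrow_arrowι D f).1 h.1,
    MorphismProperty.of_precomp _ _ _ (arrow_arrowι D f).2 h.2⟩

end FibrantReplacement

namespace LevelFactorization

variable (D : FunctorialFactorizationData (cofibrations C) (trivialFibrations C))

/-- The middle arrow of the levelwise factorization of a square as a cofibration followed by a
trivial fibration. -/
abbrev obj {i p : Arrow C} (s : i ⟶ p) : Arrow C :=
  Arrow.mk (FactorizationFunctor.map D i.hom p.hom s.w.symm)

/-- The levelwise cofibration in the factorization of a square. -/
abbrev ι {i p : Arrow C} (s : i ⟶ p) : i ⟶ obj D s :=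
  Arrow.homMk (FactorizationFunctor.ι D s.left) (FactorizationFunctor.ι D s.right) (by simp)

/-- The levelwise trivial fibration in the factorization of a square. -/
abbrev π {i p : Arrow C} (s : i ⟶ p) : obj D s ⟶ p :=
  Arrow.homMk (FactorizationFunctor.π D s.left) (FactorizationFunctor.π D s.right) (by simp)

theorem ι_π {i p : Arrow C} (s : i ⟶ p) : ι D s ≫ π D s = s := by
  ext <;> simp

/-- The functoriality of the levelwise factorization in the target of the square. -/
abbrev map {i p p' : Arrow C} (s : i ⟶ p) (g : p ⟶ p') : obj D s ⟶ obj D (s ≫ g) :=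
  Arrow.homMk (FactorizationFunctor.map D (𝟙 _) g.left (by simp))
    (FactorizationFunctor.map D (𝟙 _) g.right (by simp)) (by
      refine (FactorizationFunctor.map_map D _ _ _ _ _ _).trans
        (Eq.trans ?_ (FactorizationFunctor.map_map D _ _ _ _ _ _).symm)
      simp)

theorem ι_map {i p p' : Arrow C} (s : i ⟶ p) (g : p ⟶ p') :
    ι D s ≫ map D s g = ι D (s ≫ g) := by
  ext
  · exact (FactorizationFunctor.ι_map D _ _ _).trans (Category.id_comp _)
  · exact (FactorizationFunctor.ι_map D _ _ _).trans (Category.id_comp _)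

theorem map_π {i p p' : Arrow C} (s : i ⟶ p) (g : p ⟶ p') :
    map D s g ≫ π D (s ≫ g) = π D s ≫ g := by
  ext
  · exact FactorizationFunctor.map_π D _ _ _
  · exact FactorizationFunctor.map_π D _ _ _

theorem arrow_π {i p : Arrow C} (s : i ⟶ p) : (weakEquivalences C).arrow (π D s) :=
  ⟨(FactorizationFunctor.π_mem D _).2, (FactorizationFunctor.π_mem D _).2⟩

theorem cofibration_ι_left {i p : Arrow C} (s : i ⟶ p) : Cofibration (ι D s).left :=
  ⟨FactorizationFunctor.ι_mem D _⟩

theorem cofibration_ι_right {i p : Arrow C} (s : i ⟶ p) : Cofibration (ι D s).right :=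
  ⟨FactorizationFunctor.ι_mem D _⟩

end LevelFactorization

namespace LevelPushout

/-- The levelwise pushout of two commutative squares. -/
abbrev obj {i i' q : Arrow C} (f : i ⟶ i') (c : i ⟶ q) : Arrow C :=
  Arrow.mk ((IsPushout.of_hasPushout f.left c.left).desc (i'.hom ≫ pushout.inl f.right c.right)
    (q.hom ≫ pushout.inr f.right c.right) (by
      rw [Arrow.w_assoc, Arrow.w_assoc, pushout.condition]))

/-- The first inclusion in the levelwise pushout. -/
abbrev inl {i i' q : Arrow C} (f : i ⟶ i') (c : i ⟶ q) : i' ⟶ obj f c :=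
  Arrow.homMk (pushout.inl f.left c.left) (pushout.inl f.right c.right)
    (IsPushout.inl_desc _ _ _ _)

/-- The second inclusion in the levelwise pushout. -/
abbrev inr {i i' q : Arrow C} (f : i ⟶ i') (c : i ⟶ q) : q ⟶ obj f c :=
  Arrow.homMk (pushout.inr f.left c.left) (pushout.inr f.right c.right)
    (IsPushout.inr_desc _ _ _ _)

theorem isPushout_left {i i' q : Arrow C} (f : i ⟶ i') (c : i ⟶ q) :
    IsPushout f.left c.left (inl f c).left (inr f c).left :=
  IsPushout.of_hasPushout f.left c.left

theorem isPushout_right {i i' q : Arrow C} (f : i ⟶ i') (c : i ⟶ q) :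
    IsPushout f.right c.right (inl f c).right (inr f c).right :=
  IsPushout.of_hasPushout f.right c.right

theorem condition {i i' q : Arrow C} (f : i ⟶ i') (c : i ⟶ q) :
    f ≫ inl f c = c ≫ inr f c := by
  ext
  · exact (isPushout_left f c).w
  · exact (isPushout_right f c).w

theorem exists_desc {i i' q r : Arrow C} (f : i ⟶ i') (c : i ⟶ q) (a : i' ⟶ r) (b : q ⟶ r)
    (h : f ≫ a = c ≫ b) : ∃ d : obj f c ⟶ r, inl f c ≫ d = a ∧ inr f c ≫ d = b := by
  have hl : f.left ≫ a.left = c.left ≫ b.left := congr_arg CommaMorphism.left h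
  have hr : f.right ≫ a.right = c.right ≫ b.right := congr_arg CommaMorphism.right h
  refine ⟨Arrow.homMk ((isPushout_left f c).desc _ _ hl) ((isPushout_right f c).desc _ _ hr)
    ((isPushout_left f c).hom_ext ?_ ?_), ?_, ?_⟩
  · simp [← Arrow.w]
  · simp [← Arrow.w]
  · ext <;> simp
  · ext <;> simp

end LevelPushout

end

end ObstructionTheory
namespace ObstructionTheory

noncomputable section

variable {C : Type u} [Category.{v} C] [ModelCategory C]

theorem weakEquivalence_left {f g : Arrow C} {φ : f ⟶ g} (h : (weakEquivalences C).arrow φ) :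
    WeakEquivalence φ.left := ⟨h.1⟩

theorem weakEquivalence_right {f g : Arrow C} {φ : f ⟶ g} (h : (weakEquivalences C).arrow φ) :
    WeakEquivalence φ.right := ⟨h.2⟩

theorem LevelPushout.arrow_inr {i i' q : Arrow C} (f : i ⟶ i') (c : i ⟶ q)
    (hl : IsCobaseChangeWeakEquivalence f.left) (hr : IsCobaseChangeWeakEquivalence f.right)
    (hcl : Cofibration c.left) (hcr : Cofibration c.right) :
    (weakEquivalences C).arrow (inr f c) :=
  ⟨(hl _ _ _ (isPushout_left f c) hcl).mem, (hr _ _ _ (isPushout_right f c) hcr).mem⟩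

namespace CofibrantReplacement

open MorphismProperty (FunctorialFactorizationData)

variable (D : FunctorialFactorizationData (cofibrations C) (trivialFibrations C))

/-- The functorial cofibrant replacement of an object. -/
abbrev obj (X : C) : C := FactorizationFunctor.mid D (initial.to X)

/-- The projection from the cofibrant replacement of an object. -/
abbrev π (X : C) : obj D X ⟶ X := FactorizationFunctor.π D (initial.to X)

/-- The functorial cofibrant replacement of a morphism. -/
abbrev map {X Y : C} (f : X ⟶ Y) : obj D X ⟶ obj D Y :=
  FactorizationFunctor.map D (𝟙 _) f (Subsingleton.elim _ _)

/-- The functorial replacement of an arrow by a cofibration with cofibrant source. -/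
abbrev arrowObj (f : Arrow C) : Arrow C :=
  Arrow.mk (FactorizationFunctor.ι D (π D f.left ≫ f.hom))

/-- The action of `arrowObj` on commutative squares. -/
abbrev arrowMap {f g : Arrow C} (φ : f ⟶ g) : arrowObj D f ⟶ arrowObj D g :=
  Arrow.homMk (map D φ.left) (FactorizationFunctor.map D (map D φ.left) φ.right
    (by rw [reassoc_of% FactorizationFunctor.map_π, Category.assoc, Arrow.w])) (by simp)

/-- The projection from the replacement of an arrow by a cofibration with cofibrant source. -/
abbrev arrowπ (f : Arrow C) : arrowObj D f ⟶ f :=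
  Arrow.homMk (π D f.left) (FactorizationFunctor.π D (π D f.left ≫ f.hom)) (by simp)

theorem arrowMap_π {f g : Arrow C} (φ : f ⟶ g) :
    arrowMap D φ ≫ arrowπ D g = arrowπ D f ≫ φ := by
  ext <;> simp

theorem cofibration_arrowObj (f : Arrow C) : Cofibration (arrowObj D f).hom :=
  ⟨FactorizationFunctor.ι_mem D _⟩

theorem isCofibrant_obj (X : C) : IsCofibrant (obj D X) := by
  rw [isCofibrant_iff_of_isInitial (FactorizationFunctor.ι D (initial.to X)) initialIsInitial]
  exact ⟨FactorizationFunctor.ι_mem D _⟩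

theorem arrow_arrowπ (f : Arrow C) : (weakEquivalences C).arrow (arrowπ D f) :=
  ⟨(FactorizationFunctor.π_mem D _).2, (FactorizationFunctor.π_mem D _).2⟩

theorem arrow_arrowMap {f g : Arrow C} (φ : f ⟶ g) (hφ : (weakEquivalences C).arrow φ) :
    (weakEquivalences C).arrow (arrowMap D φ) := by
  have h : (weakEquivalences C).arrow (arrowMap D φ ≫ arrowπ D g) := by
    rw [arrowMap_π]
    exact ⟨MorphismProperty.comp_mem _ _ _ (arrow_arrowπ D f).1 hφ.1,
      MorphismProperty.comp_mem _ _ _ (arrow_arrowπ D f).2 hφ.2⟩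
  exact ⟨MorphismProperty.of_postcomp _ _ _ (arrow_arrowπ D g).1 h.1,
    MorphismProperty.of_postcomp _ _ _ (arrow_arrowπ D g).2 h.2⟩

end CofibrantReplacement

/-! ### Extending a square along `f` at the cost of a weakly equivalent target. -/

namespace Extension

variable [MorphismProperty.HasFunctorialFactorization (cofibrations C) (trivialFibrations C)]
  [MorphismProperty.HasFunctorialFactorization (trivialCofibrations C) (fibrations C)]

variable {i i' p p' p'' : Arrow C} (f : i ⟶ i')

variable (C) in
/-- A chosen functorial factorization into a cofibration and a trivial fibration. -/
abbrev cofData := MorphismProperty.functorialFactorizationData (cofibrations C)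
  (trivialFibrations C)

variable (C) in
/-- A chosen functorial factorization into a trivial cofibration and a fibration. -/
abbrev fibData := MorphismProperty.functorialFactorizationData (trivialCofibrations C)
  (fibrations C)

/-- The fibration with fibrant target which replaces an arrow. -/
abbrev R (p : Arrow C) : Arrow C := FibrantReplacement.arrowObj (fibData C) p

/-- The middle arrow of the levelwise factorization of `s`. -/
abbrev P (s : i ⟶ p) : Arrow C := LevelFactorization.obj (cofData C) s

/-- The pushout of the levelwise cofibration in the factorization of `s` along `f`. -/
abbrev E (s : i ⟶ p) : Arrow C :=
  LevelPushout.obj f (LevelFactorization.ι (cofData C) s)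

/-- The extension of `s : i ⟶ p` to a square with source `i'`. -/
def ext (s : i ⟶ p) : i' ⟶ R (E f s) :=
  LevelPushout.inl f (LevelFactorization.ι (cofData C) s) ≫
    FibrantReplacement.arrowι (fibData C) (E f s)

/-- The comparison of `p` with its replacement. -/
def toR (p : Arrow C) : p ⟶ R p := FibrantReplacement.arrowι (fibData C) p

/-- The comparison of the factorization of `s` with its target. -/
def toTarget (s : i ⟶ p) : R (P s) ⟶ R p :=
  FibrantReplacement.arrowMap (fibData C) (LevelFactorization.π (cofData C) s)

/-- The comparison of the factorization of `s` with its pushout along `f`. -/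
def toExt (s : i ⟶ p) : R (P s) ⟶ R (E f s) :=
  FibrantReplacement.arrowMap (fibData C)
    (LevelPushout.inr f (LevelFactorization.ι (cofData C) s))

theorem fac_target (s : i ⟶ p) :
    (LevelFactorization.ι (cofData C) s ≫ toR (P s)) ≫ toTarget s = s ≫ toR p := by
  rw [toR, toTarget, Category.assoc, FibrantReplacement.arrowι_map,
    reassoc_of% LevelFactorization.ι_π, toR]

theorem fac_ext (s : i ⟶ p) :
    (LevelFactorization.ι (cofData C) s ≫ toR (P s)) ≫ toExt f s = f ≫ ext f s := by
  rw [toR, toExt, ext, Category.assoc, FibrantReplacement.arrowι_map, ← Category.assoc,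
    ← Category.assoc, LevelPushout.condition]

omit [MorphismProperty.HasFunctorialFactorization (cofibrations C) (trivialFibrations C)] in
theorem arrow_toR (p : Arrow C) : (weakEquivalences C).arrow (toR p) :=
  FibrantReplacement.arrow_arrowι _ _

theorem arrow_toTarget (s : i ⟶ p) : (weakEquivalences C).arrow (toTarget s) :=
  FibrantReplacement.arrow_arrowMap _ _ (LevelFactorization.arrow_π _ _)

theorem arrow_toExt (hl : IsCobaseChangeWeakEquivalence f.left)
    (hr : IsCobaseChangeWeakEquivalence f.right) (s : i ⟶ p) :
    (weakEquivalences C).arrow (toExt f s) :=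
  FibrantReplacement.arrow_arrowMap _ _ (LevelPushout.arrow_inr _ _ hl hr
    (LevelFactorization.cofibration_ι_left _ _) (LevelFactorization.cofibration_ι_right _ _))

/-- The functoriality of the zig-zag in the target of the square. -/
theorem exists_maps (s : i ⟶ p) (g : p ⟶ p') :
    ∃ (a : R p ⟶ R p') (b : R (P s) ⟶ R (P (s ≫ g))) (c : R (E f s) ⟶ R (E f (s ≫ g))),
      toR p ≫ a = g ≫ toR p' ∧ b ≫ toTarget (s ≫ g) = toTarget s ≫ a ∧
      b ≫ toExt f (s ≫ g) = toExt f s ≫ c ∧ ext f s ≫ c = ext f (s ≫ g) := by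
  obtain ⟨d, h₁, h₂⟩ := LevelPushout.exists_desc f (LevelFactorization.ι (cofData C) s)
    (LevelPushout.inl f (LevelFactorization.ι (cofData C) (s ≫ g)))
    (LevelFactorization.map (cofData C) s g ≫
      LevelPushout.inr f (LevelFactorization.ι (cofData C) (s ≫ g)))
    (by rw [LevelPushout.condition, ← Category.assoc, LevelFactorization.ι_map])
  refine ⟨FibrantReplacement.arrowMap _ g,
    FibrantReplacement.arrowMap _ (LevelFactorization.map (cofData C) s g),
    FibrantReplacement.arrowMap _ d, FibrantReplacement.arrowι_map _ g, ?_, ?_, ?_⟩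
  · rw [toTarget, toTarget, ← FibrantReplacement.arrowMap_comp,
      ← FibrantReplacement.arrowMap_comp, LevelFactorization.map_π]
  · rw [toExt, toExt, ← FibrantReplacement.arrowMap_comp,
      ← FibrantReplacement.arrowMap_comp, h₂]
  · rw [ext, ext, Category.assoc, FibrantReplacement.arrowι_map, reassoc_of% h₁]

end Extension

/-! ### Transport of obstruction theories along one weak equivalence. -/

variable [HasZeroMorphisms C]

/-- Precomposition with a weak equivalence of cofibrations transports obstruction theories. -/
theorem HasFibrantObstructionTheory.of_source {i i' : Arrow C} (f : i ⟶ i')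
    (hi : Cofibration i.hom) (hi' : Cofibration i'.hom) (hf : (weakEquivalences C).arrow f)
    (hl : IsCobaseChangeWeakEquivalence f.left) (h : HasFibrantObstructionTheory i) :
    HasFibrantObstructionTheory i' := by
  obtain ⟨T⟩ := h
  have := weakEquivalence_right hf
  exact ⟨{
    W := T.W
    obstruction p hp hY s := T.obstruction p hp hY (f ≫ s)
    hasLift_iff p hp hY s := by rw [← hasLift_precomp_iff f hl, T.hasLift_iff p hp hY]
    functorial p p' hp hY hp' hY' s g := by
      rw [← T.functorial, Category.assoc] }⟩

theorem homotopyClass_zero_comp {W X Y : C} (f : X ⟶ Y) :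
    homotopyClass (0 : W ⟶ X) ≫ homotopyClass f = homotopyClass 0 := by
  rw [← Functor.map_comp, zero_comp]

variable [HasZeroObject C]

theorem isIso_homotopyClass_fibreMap {p p' : Arrow C} (g : p ⟶ p')
    (hp : Fibration p.hom) (hp' : Fibration p'.hom) (hY : IsFibrant p.right)
    (hY' : IsFibrant p'.right) (hg : (weakEquivalences C).arrow g) :
    IsIso (homotopyClass (fibreMap g)) := by
  have := weakEquivalence_left hg
  have := weakEquivalence_right hg
  have := weakEquivalence_fibreMap g
  exact (weakEquivalences C).Q_inverts _ (mem_weakEquivalences _)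

variable [MorphismProperty.HasFunctorialFactorization (cofibrations C) (trivialFibrations C)]
  [MorphismProperty.HasFunctorialFactorization (trivialCofibrations C) (fibrations C)]

open Extension in
/-- An obstruction theory for `i'` induces one for `i` along a weak equivalence of cofibrations
`i ⟶ i'`: a square out of `i` is extended to a square out of `i'` at the cost of replacing its
target by a weakly equivalent one. -/
theorem HasFibrantObstructionTheory.of_target {i i' : Arrow C} (f : i ⟶ i')
    (hi : Cofibration i.hom) (hi' : Cofibration i'.hom) (hf : (weakEquivalences C).arrow f)
    (hl : IsCobaseChangeWeakEquivalence f.left) (hr : IsCobaseChangeWeakEquivalence f.right)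
    (h : HasFibrantObstructionTheory i') : HasFibrantObstructionTheory i := by
  obtain ⟨T⟩ := h
  have hR (p : Arrow C) : Fibration (R p).hom := FibrantReplacement.fibration_arrowObj _ p
  have hRY (p : Arrow C) : IsFibrant (R p).right :=
    FibrantReplacement.isFibrant_arrowObj_right _ p
  have isoR (p : Arrow C) (hp : Fibration p.hom) (hY : IsFibrant p.right) :
      IsIso (homotopyClass (fibreMap (toR p))) :=
    isIso_homotopyClass_fibreMap _ hp (hR p) hY (hRY p) (arrow_toR p)
  have isoTarget {p : Arrow C} (s : i ⟶ p) : IsIso (homotopyClass (fibreMap (toTarget s))) :=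
    isIso_homotopyClass_fibreMap _ (hR _) (hR _) (hRY _) (hRY _) (arrow_toTarget s)
  have isoExt {p : Arrow C} (s : i ⟶ p) : IsIso (homotopyClass (fibreMap (toExt f s))) :=
    isIso_homotopyClass_fibreMap _ (hR _) (hR _) (hRY _) (hRY _) (arrow_toExt f hl hr s)
  have lift_iff (p : Arrow C) (hp : Fibration p.hom) (hY : IsFibrant p.right) (s : i ⟶ p) :
      HasLift s ↔ HasLift (ext f s) := by
    have := weakEquivalence_right hf
    have := weakEquivalence_left (arrow_toR p)
    have := weakEquivalence_right (arrow_toR p)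
    have := weakEquivalence_left (arrow_toTarget s)
    have := weakEquivalence_right (arrow_toTarget s)
    have := weakEquivalence_left (arrow_toExt f hl hr s)
    have := weakEquivalence_right (arrow_toExt f hl hr s)
    have := hR p
    have := hR (P s)
    have := hR (E f s)
    have := hRY p
    have := hRY (P s)
    have := hRY (E f s)
    -- Liftability is followed along the zig-zag of targets, and then from `i` to `i'`.
    rw [← hasLift_comp_iff (toR p), ← fac_target, hasLift_comp_iff (toTarget s),
      ← hasLift_comp_iff (toExt f s), fac_ext, hasLift_precomp_iff f hl]
  -- `β` is the obstruction at the middle of the zig-zag. The two equations determine `β` and `α`,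
  -- because the maps on fibres are isomorphisms.
  have obs_spec (p : Arrow C) (hp : Fibration p.hom) (hY : IsFibrant p.right) (s : i ⟶ p) :
      ∃ (α : WeakHomotopyClass T.W (fibre p)) (β : WeakHomotopyClass T.W (fibre (R (P s)))),
        β ≫ homotopyClass (fibreMap (toExt f s)) =
          T.obstruction _ (hR (E f s)) (hRY (E f s)) (ext f s) ∧
        β ≫ homotopyClass (fibreMap (toTarget s)) = α ≫ homotopyClass (fibreMap (toR p)) := by
    have := isoR p hp hY
    have := isoExt s
    exact ⟨T.obstruction _ (hR (E f s)) (hRY (E f s)) (ext f s) ≫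
      inv (homotopyClass (fibreMap (toExt f s))) ≫ homotopyClass (fibreMap (toTarget s)) ≫
      inv (homotopyClass (fibreMap (toR p))), T.obstruction _ (hR (E f s)) (hRY (E f s))
      (ext f s) ≫ inv (homotopyClass (fibreMap (toExt f s))), by simp, by simp⟩
  choose α β hβ hα using obs_spec
  refine ⟨⟨T.W, α, fun p hp hY s ↦ ?_, fun p p' hp hY hp' hY' s g ↦ ?_⟩⟩
  · have := isoR p hp hY
    have := isoExt s
    have := isoTarget s
    -- Composition with maps on fibres preserves the trivial class, and here it is cancellable, so
    -- triviality passes from the extended square to `β` and then to `α`.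
    rw [lift_iff p hp hY, T.hasLift_iff _ (hR _) (hRY _), ← hβ p hp hY,
      ← homotopyClass_zero_comp (fibreMap (toExt f s)), cancel_mono,
      ← cancel_mono (homotopyClass (fibreMap (toTarget s))), hα,
      homotopyClass_zero_comp, ← homotopyClass_zero_comp (fibreMap (toR p)), cancel_mono]
  · obtain ⟨a, b, c, ha, hb, hc, hext⟩ := exists_maps f s g
    have := isoR p' hp' hY'
    have := isoExt (s ≫ g)
    have key : β p' hp' hY' (s ≫ g) = β p hp hY s ≫ homotopyClass (fibreMap b) := by
      rw [← cancel_mono (homotopyClass (fibreMap (toExt f (s ≫ g)))), hβ, ← hext,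
        T.functorial _ _ (hR _) (hRY _), ← hβ p hp hY s, Category.assoc, Category.assoc,
        ← Functor.map_comp, ← Functor.map_comp, ← fibreMap_comp, ← fibreMap_comp, hc]
    rw [← cancel_mono (homotopyClass (fibreMap (toR p'))), ← hα, key, Category.assoc,
      Category.assoc, ← Functor.map_comp, ← Functor.map_comp, ← fibreMap_comp, ← fibreMap_comp,
      hb, ← ha, fibreMap_comp, fibreMap_comp, Functor.map_comp, Functor.map_comp,
      ← Category.assoc, hα, Category.assoc]

theorem hasFibrantObstructionTheory_iff {i i' : Arrow C} (f : i ⟶ i')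
    (hi : Cofibration i.hom) (hi' : Cofibration i'.hom) (hf : (weakEquivalences C).arrow f)
    (hl : IsCobaseChangeWeakEquivalence f.left) (hr : IsCobaseChangeWeakEquivalence f.right) :
    HasFibrantObstructionTheory i ↔ HasFibrantObstructionTheory i' :=
  ⟨.of_source f hi hi' hf hl, .of_target f hi hi' hf hl hr⟩

theorem hasFibrantObstructionTheory_iff_of_isCofibrant {i i' : Arrow C} (f : i ⟶ i')
    (hi : Cofibration i.hom) (hi' : Cofibration i'.hom) (hf : (weakEquivalences C).arrow f)
    (hA : IsCofibrant i.left) (hA' : IsCofibrant i'.left) :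
    HasFibrantObstructionTheory i ↔ HasFibrantObstructionTheory i' := by
  have := weakEquivalence_left hf
  have := weakEquivalence_right hf
  have := isCofibrant_of_cofibration i.hom
  have := isCofibrant_of_cofibration i'.hom
  exact hasFibrantObstructionTheory_iff f hi hi' hf (.of_isCofibrant _) (.of_isCofibrant _)

/-! ### Reduction of zig-zags to cofibrations with cofibrant source. -/

namespace CofibrantReplacement

open MorphismProperty (FunctorialFactorizationData)

variable (D : FunctorialFactorizationData (cofibrations C) (trivialFibrations C))

/-- The intermediate arrows need not be cofibrations nor have cofibrant sources, but their
replacements do, so each link falls under the cofibrant case. -/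
theorem hasFibrantObstructionTheory_arrowObj_iff {f g : Arrow C} (h : WeaklyEquivalent f g) :
    HasFibrantObstructionTheory (arrowObj D f) ↔ HasFibrantObstructionTheory (arrowObj D g) := by
  induction h with
  | rel f g h =>
    obtain ⟨φ, hφ⟩ := h
    exact hasFibrantObstructionTheory_iff_of_isCofibrant (arrowMap D φ)
      (cofibration_arrowObj D f) (cofibration_arrowObj D g) (arrow_arrowMap D φ hφ)
      (isCofibrant_obj D _) (isCofibrant_obj D _)
  | refl => rfl
  | symm _ _ _ h => exact h.symm
  | trans _ _ _ _ _ h h' => exact h.trans h'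

theorem hasFibrantObstructionTheory_arrowObj_iff_self (f : Arrow C) (hf : Cofibration f.hom)
    (hC : IsCofibrant f.left ∨ IsLeftProper C) :
    HasFibrantObstructionTheory (arrowObj D f) ↔ HasFibrantObstructionTheory f := by
  obtain h | h := hC
  · exact hasFibrantObstructionTheory_iff_of_isCofibrant (arrowπ D f)
      (cofibration_arrowObj D f) hf (arrow_arrowπ D f) (isCofibrant_obj D _) h
  · have := weakEquivalence_left (arrow_arrowπ D f)
    have := weakEquivalence_right (arrow_arrowπ D f)
    exact hasFibrantObstructionTheory_iff (arrowπ D f) (cofibration_arrowObj D f) hf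
      (arrow_arrowπ D f) (h.isCobaseChangeWeakEquivalence _) (h.isCobaseChangeWeakEquivalence _)

end CofibrantReplacement

end

end ObstructionTheory

theorem proposition6p3 {C : Type u} [Category.{v} C] [ModelCategory C]
    [HasZeroMorphisms C] [HasZeroObject C]
    [MorphismProperty.HasFunctorialFactorization (cofibrations C) (trivialFibrations C)]
    [MorphismProperty.HasFunctorialFactorization (trivialCofibrations C) (fibrations C)]
    {A B A' B' : C} (i : A ⟶ B) (i' : A' ⟶ B') (hi : Cofibration i) (hi' : Cofibration i')
    (hequiv : ObstructionTheory.WeaklyEquivalent (Arrow.mk i) (Arrow.mk i'))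
    (hC : (IsCofibrant A ∧ IsCofibrant A') ∨ ObstructionTheory.IsLeftProper C) :
    ObstructionTheory.HasFibrantObstructionTheory (Arrow.mk i) ↔
      ObstructionTheory.HasFibrantObstructionTheory (Arrow.mk i') := by
  let D := MorphismProperty.functorialFactorizationData (cofibrations C) (trivialFibrations C)
  have h := ObstructionTheory.CofibrantReplacement.hasFibrantObstructionTheory_arrowObj_iff D
    hequiv
  rwa [ObstructionTheory.CofibrantReplacement.hasFibrantObstructionTheory_arrowObj_iff_self D
      (Arrow.mk i) hi (hC.imp_left And.left),
    ObstructionTheory.CofibrantReplacement.hasFibrantObstructionTheory_arrowObj_iff_self D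
      (Arrow.mk i') hi' (hC.imp_left And.right)] at h
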